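/- Let $\mathbb{K}\in\{\mathbb{R},\mathbb{C}\}$. For a Banach space $X$ over $\mathbb{K}$, a weak$^*$-compact set $K\subset X^*$ and $\varepsilon>0$, let $s_\varepsilon(K)$ be the set of those $x^*\in K$ such that $\operatorname{diam}(V\cap K)>\varepsilon$ (diameter in the norm of $X^*$) for every weak$^*$-neighborhood $V$ of $x^*$, and let $s_\varepsilon(K)=K$ for $\varepsilon\leqslant 0$. For $M\geqslant 0$, the set $K$ has $M$-summable Szlenk index if $\sum_{i=1}^n\varepsilon_i\leqslant M$ whenever $\varepsilon_1,\ldots,\varepsilon_n\in\mathbb{R}$ are such that $s_{\varepsilon_1}\cdots s_{\varepsilon_n}(K)\neq\varnothing$. A bounded linear operator $A:X\to Y$ between Banach spaces has $M$-summable Szlenk index if $A^*B_{Y^*}$ does, where $B_{Y^*}$ is the closed unit ball of $Y^*$, and it has summable Szlenk index if it has $M$-summable Szlenk index for some $M\geqslant 0$. Theorem. Let $\Lambda$ be a non-empty set and, for each $\lambda\in\Lambda$, let $A_\lambda:X_\lambda\to Y_\lambda$ be a bounded linear operator between Banach spaces over $\mathbb{K}$, with $\sup_{\lambda\in\Lambda}\|A_\lambda\|<\infty$.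 Let $$A:\Bigl(\bigoplus_{\lambda\in\Lambda}X_\lambda\Bigr)_{c_0(\Lambda)}\to\Bigl(\bigoplus_{\lambda\in\Lambda}Y_\lambda\Bigr)_{c_0(\Lambda)},\qquad A\bigl((x_\lambda)_{\lambda\in\Lambda}\bigr)=(A_\lambda x_\lambda)_{\lambda\in\Lambda},$$ be the induced operator, where the $c_0(\Lambda)$-direct sum consists of the families $(x_\lambda)_{\lambda\in\Lambda}$ such that $\{\lambda:\|x_\lambda\|>\delta\}$ is finite for every $\delta>0$, with the norm $\sup_\lambda\|x_\lambda\|$. Then $A$ has summable Szlenk index if and only if there exists $M\geqslant 0$ such that, for every $\lambda\in\Lambda$, $A_\lambda$ has $M$-summable Szlenk index. -/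

import Mathlib

open Filter Topology
open scoped ENNReal

noncomputable section

/-! ### The Szlenk derivation and summable Szlenk index -/

section Szlenk

variable {𝕜 : Type*} [RCLike 𝕜]
variable {X : Type*} [NormedAddCommGroup X] [NormedSpace 𝕜 X]
variable {Y : Type*} [NormedAddCommGroup Y] [NormedSpace 𝕜 Y]

/-- The Szlenk derivation `s_ε(K)` of a set `K ⊆ X*`: those `f ∈ K` such that every
weak-star neighbourhood `V` of `f` satisfies `diam (V ∩ K) > ε`, the diameter being taken in the
dual norm. For `ε ≤ 0` one has `s_ε(K) = K` by convention. -/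
def szlenkDeriv (ε : ℝ) (K : Set (StrongDual 𝕜 X)) : Set (StrongDual 𝕜 X) :=
  {f | f ∈ K ∧ (0 < ε → ∀ V ∈ 𝓝 (StrongDual.toWeakDual f),
    ENNReal.ofReal ε < Metric.ediam ((StrongDual.toWeakDual ⁻¹' V) ∩ K))}

/-- The iterated derivation `s_{ε₁} s_{ε₂} ⋯ s_{εₙ}(K)` for the list `[ε₁, …, εₙ]`
(so `s_{εₙ}` is applied first). -/
def szlenkDerivList (l : List ℝ) (K : Set (StrongDual 𝕜 X)) : Set (StrongDual 𝕜 X) :=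
  l.foldr szlenkDeriv K

/-- `K` has `M`-summable Szlenk index (used for `M ≥ 0`): whenever
`s_{ε₁} ⋯ s_{εₙ}(K)` is non-empty, `ε₁ + ⋯ + εₙ ≤ M`. -/
def SetHasSummableSzlenkIndexWith (M : ℝ) (K : Set (StrongDual 𝕜 X)) : Prop :=
  ∀ l : List ℝ, (szlenkDerivList l K).Nonempty → l.sum ≤ M

/-- The set `A^* B_{Y^*}`, the image of the closed dual unit ball of `Y` under the adjoint
`f ↦ f ∘ A` of the operator `A : X → Y`. -/
def adjointBall (A : X →L[𝕜] Y) : Set (StrongDual 𝕜 X) :=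
  (fun f : StrongDual 𝕜 Y => f.comp A) '' Metric.closedBall 0 1

/-- The operator `A` has `M`-summable Szlenk index. -/
def HasSummableSzlenkIndexWith (M : ℝ) (A : X →L[𝕜] Y) : Prop :=
  SetHasSummableSzlenkIndexWith M (adjointBall A)

/-- The operator `A` has summable Szlenk index. -/
def HasSummableSzlenkIndex (A : X →L[𝕜] Y) : Prop :=
  ∃ M : ℝ, 0 ≤ M ∧ HasSummableSzlenkIndexWith M A

end Szlenk

/-! ### The `c₀(Λ)`-direct sum of spaces and of operators -/

section DirectSum

variable {Λ : Type*}

/-- The `c₀(Λ)`-direct sum of the spaces `E i`: the families `x` in the product with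
`‖x i‖ → 0` along the cofinite filter of `Λ`, with the supremum norm
(as a subspace of the `ℓ_∞(Λ)`-direct sum). -/
def c0Sum (𝕜 : Type*) [RCLike 𝕜] (E : Λ → Type*) [∀ i, NormedAddCommGroup (E i)]
    [∀ i, NormedSpace 𝕜 (E i)] : Submodule 𝕜 (lp E ∞) where
  carrier := {x | Tendsto (fun i => ‖x i‖) cofinite (𝓝 0)}
  zero_mem' := by simpa using (tendsto_const_nhds : Tendsto (fun _ : Λ => (0 : ℝ)) cofinite (𝓝 0))
  add_mem' := by
    intro x y hx hy
    have h : Tendsto (fun i => ‖x i‖ + ‖y i‖) cofinite (𝓝 0) := by simpa using hx.add hy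
    exact squeeze_zero (fun _ => norm_nonneg _) (fun i => norm_add_le (x i) (y i)) h
  smul_mem' := by
    intro c x hx
    have h : Tendsto (fun i => ‖c‖ * ‖x i‖) cofinite (𝓝 0) := by simpa using hx.const_mul ‖c‖
    exact squeeze_zero (fun _ => norm_nonneg _) (fun i => (norm_smul c (x i)).le) h

variable {𝕜 : Type*} [RCLike 𝕜]
variable {X : Λ → Type*} [∀ i, NormedAddCommGroup (X i)] [∀ i, NormedSpace 𝕜 (X i)]
variable {Y : Λ → Type*} [∀ i, NormedAddCommGroup (Y i)] [∀ i, NormedSpace 𝕜 (Y i)]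

/-- Coordinatewise bound for a uniformly bounded family of operators. -/
theorem norm_apply_le_iSup_mul (A : ∀ i, X i →L[𝕜] Y i)
    (hA : BddAbove (Set.range fun i => ‖A i‖)) (x : lp X ∞) (i : Λ) :
    ‖A i (x i)‖ ≤ (⨆ j, ‖A j‖) * ‖x i‖ :=
  (A i).le_of_opNorm_le (le_ciSup hA i) (x i)

/-- Coordinatewise bound by the supremum norm. -/
theorem norm_apply_le_iSup_mul_norm (A : ∀ i, X i →L[𝕜] Y i)
    (hA : BddAbove (Set.range fun i => ‖A i‖)) (x : lp X ∞) (i : Λ) :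
    ‖A i (x i)‖ ≤ (⨆ j, ‖A j‖) * ‖x‖ :=
  (norm_apply_le_iSup_mul A hA x i).trans <|
    mul_le_mul_of_nonneg_left (lp.norm_apply_le_norm ENNReal.top_ne_zero x i)
      (Real.iSup_nonneg fun _ => norm_nonneg _)

/-- The operator between `c₀(Λ)`-direct sums induced by a uniformly bounded family
`A i : X i → Y i`, namely `(x i) ↦ (A i (x i))`. -/
def c0SumMap (A : ∀ i, X i →L[𝕜] Y i) (hA : BddAbove (Set.range fun i => ‖A i‖)) :
    c0Sum 𝕜 X →L[𝕜] c0Sum 𝕜 Y :=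
  LinearMap.mkContinuous
    { toFun := fun x =>
        ⟨⟨fun i => A i ((x : lp X ∞) i), memℓp_infty ⟨(⨆ j, ‖A j‖) * ‖(x : lp X ∞)‖, by
            rintro _ ⟨i, rfl⟩
            exact norm_apply_le_iSup_mul_norm A hA x i⟩⟩, by
          have hx : Tendsto (fun i => ‖(x : lp X ∞) i‖) cofinite (𝓝 0) := x.2
          have h : Tendsto (fun i => (⨆ j, ‖A j‖) * ‖(x : lp X ∞) i‖) cofinite (𝓝 0) := by
            simpa using hx.const_mul (⨆ j, ‖A j‖)
          exact squeeze_zero (fun _ => norm_nonneg _)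
            (fun i => norm_apply_le_iSup_mul A hA x i) h⟩
      map_add' := by
        intro x y
        ext i
        exact (A i).map_add _ _
      map_smul' := by
        intro c x
        ext i
        exact (A i).map_smul c _ }
    (⨆ j, ‖A j‖)
    (by
      intro x
      exact lp.norm_le_of_forall_le
        (mul_nonneg (Real.iSup_nonneg fun _ => norm_nonneg _) (norm_nonneg _))
        (fun i => norm_apply_le_iSup_mul_norm A hA x i))

end DirectSum

end

/-!
The dual of the `c₀`-direct sum is the `ℓ₁`-direct sum of the duals, and the coordinate projections
embed each `(A i)^* B` into the set of the induced operator, isometrically and weak-star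
continuously; hence summability passes from the direct sum to its coordinates with the same
constant (`HasSummableSzlenkIndexWith.of_c0SumMap`).

For the converse, let `‖A i‖ ≤ C` and let every `A i` have `M`-summable Szlenk index. To each
functional `f` on a summand one attaches a potential (`szlenkPotential`), the infimum of
`(2 C + M) t - ∑ aⱼ` over all `t` and `a₁, …, aₙ ≥ 0` with `f ∈ s_{a₁} ⋯ s_{aₙ}(t A^* B)`.
Summability and scaling give `∑ aⱼ ≤ M t`, so the potential is at least `2 C t ≥ ‖f‖`
(`enorm_le_szlenkPotential`). On the other hand, when `g` tends weak-star to `f`, the potential of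
`f` with `n + 1` parameters is asymptotically at most the potential of `g` with `n` parameters minus
`‖g - f‖`, because the distance `‖g - f‖` can be used as an additional parameter for `f`
(`eventually_szlenkPotential_succ_add_le`).

These two properties are inherited by the sum of the potentials over all coordinates
(`eventually_sumPotential_succ_add_le`): on finitely many coordinates the drop is the one of the
summands, and the part of `g` which escapes to the remaining coordinates is paid for by the
potential dominating the norm. The summed potential is at most `2 C + M` on the image of the dual
ball, it is non-negative, and every derivation `s_ε` lowers it by `ε / 2`; so the parameters of a
non-empty iterated derivation add up to at most `2 (2 C + M)`. The factor `2` comes from passing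
between diameters and distances to the centre, and is lost only once.
-/

/-! ### The Szlenk derivation and weak-star convergence -/

section Derivation

variable {𝕜 : Type*} [RCLike 𝕜]
variable {E : Type*} [NormedAddCommGroup E] [NormedSpace 𝕜 E]
variable {F : Type*} [NormedAddCommGroup F] [NormedSpace 𝕜 F]

/-- The filter of weak-star neighbourhoods of a functional, as a filter on the normed dual. -/
noncomputable def weakStarNhds (f : StrongDual 𝕜 E) : Filter (StrongDual 𝕜 E) :=
  comap StrongDual.toWeakDual (𝓝 (StrongDual.toWeakDual f))

/-- Weak-star closedness of a subset of the normed dual: it contains each of its weak-star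
cluster points. -/
def IsWeakStarClosed (K : Set (StrongDual 𝕜 E)) : Prop :=
  ∀ f, (∃ᶠ g in weakStarNhds f, g ∈ K) → f ∈ K

theorem tendsto_apply_weakStarNhds (f : StrongDual 𝕜 E) (x : E) :
    Tendsto (fun g : StrongDual 𝕜 E => g x) (weakStarNhds f) (𝓝 (f x)) :=
  ((WeakDual.eval_continuous x).tendsto (StrongDual.toWeakDual f)).comp tendsto_comap

theorem tendsto_weakStarNhds {α : Type*} {l : Filter α} {u : α → StrongDual 𝕜 E}
    {f : StrongDual 𝕜 E} (h : ∀ x, Tendsto (fun a => u a x) l (𝓝 (f x))) :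
    Tendsto u l (weakStarNhds f) :=
  tendsto_comap_iff.2 <|
    (tendsto_iff_forall_eval_tendsto_topDualPairing (𝕜 := 𝕜)).2 h

theorem pure_le_weakStarNhds (f : StrongDual 𝕜 E) : pure f ≤ weakStarNhds f :=
  tendsto_weakStarNhds (u := id) (l := pure f) fun _ => tendsto_pure_nhds _ _

/-- Every weak-star neighbourhood contains one on which it is still a neighbourhood of
each point. -/
theorem eventually_eventually_weakStarNhds {f : StrongDual 𝕜 E} {p : StrongDual 𝕜 E → Prop}
    (h : ∀ᶠ g in weakStarNhds f, p g) :
    ∀ᶠ g in weakStarNhds f, ∀ᶠ k in weakStarNhds g, p k := by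
  rw [weakStarNhds, eventually_comap] at h ⊢
  filter_upwards [eventually_eventually_nhds.2 h] with v hv g hg
  rw [weakStarNhds, eventually_comap, hg]
  exact hv

theorem mem_szlenkDeriv_iff {ε : ℝ} {K : Set (StrongDual 𝕜 E)} {f : StrongDual 𝕜 E} :
    f ∈ szlenkDeriv ε K ↔
      f ∈ K ∧ (0 < ε → ∀ U ∈ weakStarNhds f, ENNReal.ofReal ε < Metric.ediam (U ∩ K)) := by
  refine and_congr_right fun _ => imp_congr_right fun _ => ⟨fun h U hU => ?_, fun h V hV => ?_⟩
  · obtain ⟨V, hV, hVU⟩ := mem_comap.1 hU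
    exact (h V hV).trans_le (Metric.ediam_mono (Set.inter_subset_inter_left _ hVU))
  · exact h _ (preimage_mem_comap hV)

theorem szlenkDeriv_subset (ε : ℝ) (K : Set (StrongDual 𝕜 E)) : szlenkDeriv ε K ⊆ K :=
  fun _ hf => hf.1

theorem szlenkDeriv_mono {ε δ : ℝ} (h : δ ≤ ε) {K L : Set (StrongDual 𝕜 E)} (hKL : K ⊆ L) :
    szlenkDeriv ε K ⊆ szlenkDeriv δ L := by
  intro f hf
  rw [mem_szlenkDeriv_iff] at hf ⊢
  exact ⟨hKL hf.1, fun hδ U hU => (ENNReal.ofReal_le_ofReal h).trans_lt <|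
    (hf.2 (hδ.trans_le h) U hU).trans_le (Metric.ediam_mono (Set.inter_subset_inter_right _ hKL))⟩

theorem IsWeakStarClosed.deriv {K : Set (StrongDual 𝕜 E)} (hK : IsWeakStarClosed K)
    (ε : ℝ) : IsWeakStarClosed (szlenkDeriv ε K) := by
  intro f hf
  refine mem_szlenkDeriv_iff.2 ⟨hK f (hf.mono fun g hg => hg.1), fun hε U hU => ?_⟩
  obtain ⟨g, hg, hgU⟩ := (hf.and_eventually (eventually_eventually_weakStarNhds hU)).exists
  exact (mem_szlenkDeriv_iff.1 hg).2 hε U hgU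

/-- A weak-star limit of points of `K` that stay at distance more than `ε` from it belongs to
`s_ε(K)`. -/
theorem IsWeakStarClosed.mem_szlenkDeriv {K : Set (StrongDual 𝕜 E)} (hK : IsWeakStarClosed K)
    {ε : ℝ} {f : StrongDual 𝕜 E} (h : ∃ᶠ g in weakStarNhds f, g ∈ K ∧ ε < ‖g - f‖) :
    f ∈ szlenkDeriv ε K := by
  have hf : f ∈ K := hK f (h.mono fun g hg => hg.1)
  refine mem_szlenkDeriv_iff.2 ⟨hf, fun hε U hU => ?_⟩
  obtain ⟨g, ⟨hgK, hg⟩, hgU⟩ := (h.and_eventually hU).exists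
  have hfU : f ∈ U := pure_le_weakStarNhds f hU
  calc ENNReal.ofReal ε < ENNReal.ofReal ‖g - f‖ :=
        (ENNReal.ofReal_lt_ofReal_iff (hε.trans hg)).2 hg
    _ = edist g f := by rw [edist_dist, dist_eq_norm]
    _ ≤ _ := Metric.edist_le_ediam_of_mem (show g ∈ U ∩ K from ⟨hgU, hgK⟩) ⟨hfU, hf⟩

/-- Partial converse of `IsWeakStarClosed.mem_szlenkDeriv`, at the cost of a factor `2` between
the diameter and the radius. -/
theorem exists_half_lt_of_mem_szlenkDeriv {K : Set (StrongDual 𝕜 E)} {ε : ℝ} (hε : 0 < ε)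
    {f : StrongDual 𝕜 E} (hf : f ∈ szlenkDeriv ε K) {p : StrongDual 𝕜 E → Prop}
    (hp : ∀ᶠ g in weakStarNhds f, p g) : ∃ g ∈ K, p g ∧ ε / 2 < ‖g - f‖ := by
  by_contra! h
  refine ((mem_szlenkDeriv_iff.1 hf).2 hε _ hp).not_ge (Metric.ediam_le ?_)
  rintro g ⟨hg, hgK⟩ k ⟨hk, hkK⟩
  rw [edist_dist]
  refine ENNReal.ofReal_le_ofReal ?_
  have h1 := h g hgK hg
  have h2 := h k hkK hk
  rw [← dist_eq_norm] at h1 h2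
  linarith [dist_triangle_right g k f]

theorem szlenkDerivList_cons (ε : ℝ) (l : List ℝ) (K : Set (StrongDual 𝕜 E)) :
    szlenkDerivList (ε :: l) K = szlenkDeriv ε (szlenkDerivList l K) := rfl

theorem szlenkDerivList_subset (l : List ℝ) (K : Set (StrongDual 𝕜 E)) :
    szlenkDerivList l K ⊆ K := by
  induction l with
  | nil => exact subset_rfl
  | cons ε l ih => exact (szlenkDeriv_subset ε _).trans ih

theorem IsWeakStarClosed.derivList {K : Set (StrongDual 𝕜 E)} (hK : IsWeakStarClosed K)
    (l : List ℝ) : IsWeakStarClosed (szlenkDerivList l K) := by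
  induction l with
  | nil => exact hK
  | cons ε l ih => exact ih.deriv ε

theorem szlenkDerivList_ofFn_mono {n : ℕ} {a b : Fin n → ℝ} (h : b ≤ a)
    {K L : Set (StrongDual 𝕜 E)} (hKL : K ⊆ L) :
    szlenkDerivList (List.ofFn a) K ⊆ szlenkDerivList (List.ofFn b) L := by
  induction n with
  | zero => simpa [szlenkDerivList] using hKL
  | succ n ih =>
    rw [List.ofFn_succ, List.ofFn_succ]
    exact szlenkDeriv_mono (h 0) (ih fun i => h i.succ)

/-- Szlenk derivations are transported by weak-star continuous maps that multiply distances by a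
constant. -/
theorem mapsTo_szlenkDerivList {T : StrongDual 𝕜 E → StrongDual 𝕜 F} {c : ℝ} (hc : 0 < c)
    (hT : ∀ f g, dist (T f) (T g) = c * dist f g)
    (hcont : ∀ f, Tendsto T (weakStarNhds f) (weakStarNhds (T f)))
    {K : Set (StrongDual 𝕜 E)} {L : Set (StrongDual 𝕜 F)} (hKL : Set.MapsTo T K L) (l : List ℝ) :
    Set.MapsTo T (szlenkDerivList l K) (szlenkDerivList (l.map (c * ·)) L) := by
  induction l with
  | nil => exact hKL
  | cons ε l ih =>
    intro f hf
    rw [szlenkDerivList_cons, mem_szlenkDeriv_iff] at hf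
    rw [List.map_cons, szlenkDerivList_cons, mem_szlenkDeriv_iff]
    refine ⟨ih hf.1, fun hε U hU => ?_⟩
    have hε' : 0 < ε := pos_of_mul_pos_right hε hc.le
    by_contra! hle
    refine (hf.2 hε' _ (hcont f hU)).not_ge (Metric.ediam_le ?_)
    rintro g ⟨hgU, hg⟩ k ⟨hkU, hk⟩
    have h : edist (T g) (T k) ≤ ENNReal.ofReal (c * ε) :=
      (Metric.edist_le_ediam_of_mem (show T g ∈ U ∩ _ from ⟨hgU, ih hg⟩)
        (show T k ∈ U ∩ _ from ⟨hkU, ih hk⟩)).trans hle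
    rw [edist_dist, ENNReal.ofReal_le_ofReal_iff hε.le, hT] at h
    rw [edist_dist]
    exact ENNReal.ofReal_le_ofReal (le_of_mul_le_mul_left h hc)

end Derivation

/-! ### The potential of an operator with summable Szlenk index -/

section Potential

variable {𝕜 : Type*} [RCLike 𝕜]
variable {E : Type*} [NormedAddCommGroup E] [NormedSpace 𝕜 E]
variable {F : Type*} [NormedAddCommGroup F] [NormedSpace 𝕜 F]

/-- The image `t A^* B_{F^*}` under the adjoint of the closed ball of radius `t`. -/
def scaledAdjointBall (A : E →L[𝕜] F) (t : ℝ) : Set (StrongDual 𝕜 E) :=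
  (fun h : StrongDual 𝕜 F => h.comp A) '' Metric.closedBall 0 t

theorem mem_adjointBall_iff {A : E →L[𝕜] F} {f : StrongDual 𝕜 E} :
    f ∈ adjointBall A ↔ ∃ h : StrongDual 𝕜 F, ‖h‖ ≤ 1 ∧ h.comp A = f := by
  simp [adjointBall]

theorem scaledAdjointBall_mono (A : E →L[𝕜] F) {s t : ℝ} (h : s ≤ t) :
    scaledAdjointBall A s ⊆ scaledAdjointBall A t :=
  Set.image_mono (Metric.closedBall_subset_closedBall h)

theorem norm_le_of_mem_scaledAdjointBall {A : E →L[𝕜] F} {C t : ℝ} (hA : ‖A‖ ≤ C)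
    (ht : 0 ≤ t) {f : StrongDual 𝕜 E} (hf : f ∈ scaledAdjointBall A t) : ‖f‖ ≤ C * t := by
  obtain ⟨h, hh, rfl⟩ := hf
  rw [mem_closedBall_zero_iff] at hh
  calc ‖h.comp A‖ ≤ ‖h‖ * ‖A‖ := h.opNorm_comp_le A
    _ ≤ t * C := mul_le_mul hh hA (norm_nonneg _) ht
    _ = C * t := mul_comm _ _

theorem isWeakStarClosed_scaledAdjointBall (A : E →L[𝕜] F) (t : ℝ) :
    IsWeakStarClosed (scaledAdjointBall A t) := by
  have hcont : Continuous fun w : WeakDual 𝕜 F =>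
      StrongDual.toWeakDual ((WeakDual.toStrongDual w).comp A) :=
    WeakDual.continuous_of_continuous_eval fun x => WeakDual.eval_continuous (A x)
  have hcl := ((WeakDual.isCompact_closedBall (0 : StrongDual 𝕜 F) t).image hcont).isClosed
  intro f hf
  obtain ⟨w, hw, hwf⟩ := hcl.mem_of_frequently_of_tendsto (b := weakStarNhds f)
    (f := StrongDual.toWeakDual) (hf.mono fun g hg => by
      obtain ⟨h, hh, rfl⟩ := hg
      exact ⟨StrongDual.toWeakDual h, hh, rfl⟩) tendsto_comap
  exact ⟨WeakDual.toStrongDual w, hw, StrongDual.toWeakDual.injective hwf⟩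

theorem list_sum_le_of_mem_szlenkDerivList {A : E →L[𝕜] F} {M : ℝ}
    (hA : HasSummableSzlenkIndexWith M A) {t : ℝ} (ht : 0 < t) {l : List ℝ}
    {f : StrongDual 𝕜 E} (hf : f ∈ szlenkDerivList l (scaledAdjointBall A t)) :
    l.sum ≤ M * t := by
  have hnorm : ‖((t⁻¹ : ℝ) : 𝕜)‖ = t⁻¹ := by
    rw [RCLike.norm_ofReal, abs_of_pos (inv_pos.2 ht)]
  have hmaps : Set.MapsTo (fun f : StrongDual 𝕜 E => ((t⁻¹ : ℝ) : 𝕜) • f)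
      (scaledAdjointBall A t) (adjointBall A) := by
    rintro _ ⟨h, hh, rfl⟩
    refine ⟨((t⁻¹ : ℝ) : 𝕜) • h, ?_, rfl⟩
    rw [mem_closedBall_zero_iff] at hh ⊢
    rw [norm_smul, hnorm, inv_mul_le_iff₀ ht, mul_one]
    exact hh
  have h := hA _ ⟨_, mapsTo_szlenkDerivList (inv_pos.2 ht)
    (fun f g => by
      have h : ((t⁻¹ : ℝ) : 𝕜) • f - ((t⁻¹ : ℝ) : 𝕜) • g = ((t⁻¹ : ℝ) : 𝕜) • (f - g) :=
        ContinuousLinearMap.ext fun x => (mul_sub _ _ _).symm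
      rw [dist_eq_norm, dist_eq_norm, h]
      exact (norm_smul ((t⁻¹ : ℝ) : 𝕜) (f - g)).trans (by rw [hnorm]))
    (fun f => tendsto_weakStarNhds fun x =>
      (tendsto_apply_weakStarNhds f x).const_mul ((t⁻¹ : ℝ) : 𝕜)) hmaps l hf⟩
  rw [List.sum_map_mul_left, List.map_id', inv_mul_le_iff₀ ht] at h
  linarith

/-- The `n`-step potential of an operator `A` with weight `N`: the infimum of `N t - ∑ aᵢ` over
the radii `t > 0` and the non-negative `a₁, …, aₙ` with `f ∈ s_{a₁} ⋯ s_{aₙ}(t A^* B_{F^*})`. It is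
`∞` if there are none. -/
noncomputable def szlenkPotential (N : ℝ) (A : E →L[𝕜] F) (n : ℕ) (f : StrongDual 𝕜 E) : ℝ≥0∞ :=
  ⨅ (q : ℝ × (Fin n → ℝ)) (_ : 0 < q.1 ∧ 0 ≤ q.2 ∧
    f ∈ szlenkDerivList (List.ofFn q.2) (scaledAdjointBall A q.1)),
      ENNReal.ofReal (N * q.1 - ∑ i, q.2 i)

theorem szlenkPotential_le (N : ℝ) (A : E →L[𝕜] F) {n : ℕ} {f : StrongDual 𝕜 E} {t : ℝ}
    {a : Fin n → ℝ} (ht : 0 < t) (ha : 0 ≤ a)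
    (hf : f ∈ szlenkDerivList (List.ofFn a) (scaledAdjointBall A t)) :
    szlenkPotential N A n f ≤ ENNReal.ofReal (N * t - ∑ i, a i) :=
  iInf₂_le (t, a) ⟨ht, ha, hf⟩

theorem szlenkPotential_succ_le (N : ℝ) (A : E →L[𝕜] F) (n : ℕ) (f : StrongDual 𝕜 E) :
    szlenkPotential N A (n + 1) f ≤ szlenkPotential N A n f := by
  refine le_iInf₂ fun ⟨t, a⟩ ⟨ht, ha, hf⟩ => ?_
  refine (szlenkPotential_le N A (a := Fin.cons 0 a) ht ?_ ?_).trans_eq ?_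
  · intro i
    cases i using Fin.cases with
    | zero => simp
    | succ i => simpa using ha i
  · rw [List.ofFn_succ]
    rw [szlenkDerivList_cons]
    exact ⟨by simpa using hf, fun h => by simp at h⟩
  · simp [Fin.sum_univ_succ]

theorem szlenkPotential_zero_comp_le {N : ℝ} (A : E →L[𝕜] F) (h : StrongDual 𝕜 F) :
    szlenkPotential N A 0 (h.comp A) ≤ ENNReal.ofReal (N * ‖h‖) := by
  have hlim : Tendsto (fun t : ℝ => ENNReal.ofReal (N * t)) (𝓝[>] ‖h‖)
      (𝓝 (ENNReal.ofReal (N * ‖h‖))) :=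
    (ENNReal.continuous_ofReal.comp (continuous_const.mul continuous_id)).continuousAt.mono_left
      nhdsWithin_le_nhds
  refine ge_of_tendsto hlim ?_
  filter_upwards [self_mem_nhdsWithin] with t ht
  have ht' : ‖h‖ < t := ht
  refine (szlenkPotential_le N A (a := 0) ((norm_nonneg h).trans_lt ht') le_rfl ?_).trans_eq ?_
  · exact ⟨h, mem_closedBall_zero_iff.2 ht'.le, rfl⟩
  · simp

theorem enorm_le_szlenkPotential {A : E →L[𝕜] F} {C M : ℝ} (hC : ‖A‖ ≤ C)
    (hA : HasSummableSzlenkIndexWith M A) (n : ℕ) (f : StrongDual 𝕜 E) :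
    ‖f‖ₑ ≤ szlenkPotential (2 * C + M) A n f := by
  refine le_iInf₂ fun ⟨t, a⟩ ⟨ht, ha, hf⟩ => ?_
  rw [← ofReal_norm]
  refine ENNReal.ofReal_le_ofReal ?_
  have h1 := list_sum_le_of_mem_szlenkDerivList hA ht hf
  rw [List.sum_ofFn] at h1
  have h2 := norm_le_of_mem_scaledAdjointBall hC ht.le (szlenkDerivList_subset _ _ hf)
  have h3 := norm_nonneg f
  dsimp only
  linarith

/-- In the weak-star limit the potential drops at least by the distance to the limit. The
parameters `(t, a)` nearly attaining the potential at points near `f` stay in a compact set; along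
an ultrafilter they converge, and weak-star closedness of the derived sets shows that `f` itself
survives one further derivation, with parameter the limiting distance. -/
theorem eventually_szlenkPotential_succ_add_le {A : E →L[𝕜] F} {C M : ℝ} (hC0 : 0 < C)
    (hM : 0 ≤ M) (hC : ‖A‖ ≤ C) (hA : HasSummableSzlenkIndexWith M A) (n : ℕ)
    {f : StrongDual 𝕜 E} (hf : szlenkPotential (2 * C + M) A (n + 1) f ≠ ∞) {η : ℝ} (hη : 0 < η) :
    ∀ᶠ g in weakStarNhds f, szlenkPotential (2 * C + M) A (n + 1) f + ENNReal.ofReal ‖g - f‖ ≤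
      szlenkPotential (2 * C + M) A n g + ENNReal.ofReal η := by
  set N : ℝ := 2 * C + M with hN
  have hN0 : 0 < N := by positivity
  set p : ℝ := (szlenkPotential N A (n + 1) f).toReal with hp
  have hp0 : 0 ≤ p := ENNReal.toReal_nonneg
  have hfp : szlenkPotential N A (n + 1) f = ENNReal.ofReal p := (ENNReal.ofReal_toReal hf).symm
  by_contra hcon
  -- nearly optimal parameters at the points where the inequality fails
  have hfreq : ∃ᶠ g in weakStarNhds f, ∃ q : ℝ × (Fin n → ℝ),
      (0 < q.1 ∧ 0 ≤ q.2 ∧ g ∈ szlenkDerivList (List.ofFn q.2) (scaledAdjointBall A q.1)) ∧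
        N * q.1 - ∑ i, q.2 i + η < p + ‖g - f‖ := by
    refine (not_eventually.1 hcon).mono fun g hg => ?_
    rw [not_le, ← lt_tsub_iff_right, szlenkPotential] at hg
    simp only [iInf_lt_iff] at hg
    obtain ⟨q, hq, hlt⟩ := hg
    refine ⟨q, hq, ?_⟩
    rw [lt_tsub_iff_right, hfp, ← ENNReal.ofReal_add hp0 (norm_nonneg _)] at hlt
    have hcost : 0 ≤ N * q.1 - ∑ i, q.2 i := by
      have h1 := list_sum_le_of_mem_szlenkDerivList hA hq.1 hq.2.2
      rw [List.sum_ofFn] at h1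
      have := mul_pos hC0 hq.1
      linarith
    rw [← ENNReal.ofReal_add hcost hη.le] at hlt
    exact (ENNReal.ofReal_lt_ofReal_iff' .. |>.1 hlt).1
  obtain ⟨u, hu, huq⟩ : ∃ u : Ultrafilter (StrongDual 𝕜 E), (u : Filter _) ≤ weakStarNhds f ∧
      ∀ᶠ g in u, ∃ q : ℝ × (Fin n → ℝ),
      (0 < q.1 ∧ 0 ≤ q.2 ∧ g ∈ szlenkDerivList (List.ofFn q.2) (scaledAdjointBall A q.1)) ∧
        N * q.1 - ∑ i, q.2 i + η < p + ‖g - f‖ := by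
    obtain ⟨u, hu⟩ := @Ultrafilter.exists_le _ _ (frequently_mem_iff_neBot.1 hfreq)
    exact ⟨u, hu.trans inf_le_left, le_principal_iff.1 (hu.trans inf_le_right)⟩
  obtain ⟨q, hq⟩ := skolem.1 huq
  -- `2 C t ≤ N t - ∑ aᵢ < p + ‖g‖ + ‖f‖` and `‖g‖ ≤ C t` bound `t` by `R`
  set R : ℝ := (p + ‖f‖) / C with hR
  have hmem : ∀ᶠ g in u, q g ∈ Set.Icc (0 : ℝ) R ×ˢ Set.Icc (0 : Fin n → ℝ) (fun _ => M * R) := by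
    filter_upwards [hq] with g ⟨⟨ht, ha, hg⟩, hlt⟩
    have h1 := list_sum_le_of_mem_szlenkDerivList hA ht hg
    rw [List.sum_ofFn] at h1
    have h2 := norm_le_of_mem_scaledAdjointBall hC ht.le (szlenkDerivList_subset _ _ hg)
    have h3 := norm_sub_le g f
    have h4 : (q g).1 ≤ R := by
      rw [hR, le_div_iff₀ hC0]
      linarith
    refine ⟨⟨ht.le, h4⟩, ha, fun i => ?_⟩
    calc (q g).2 i ≤ ∑ i, (q g).2 i :=
          Finset.single_le_sum (fun j _ => ha j) (Finset.mem_univ i)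
      _ ≤ M * (q g).1 := h1
      _ ≤ M * R := mul_le_mul_of_nonneg_left h4 hM
  obtain ⟨⟨t₀, a₀⟩, ⟨⟨ht₀, -⟩, -⟩, hlim⟩ := (isCompact_Icc.prod isCompact_Icc).ultrafilter_le_nhds
    (u.map q) (le_principal_iff.2 hmem)
  have hlim : Tendsto q u (𝓝 (t₀, a₀)) := hlim
  -- the margin `δ` is chosen so that rounding `t` up and the `aᵢ` down costs at most `η / 2`
  set δ : ℝ := η / (4 * (N + n)) with hδ
  have hδ0 : 0 < δ := by positivity
  have hδη : 2 * N * δ + n * (2 * δ) = η / 2 := by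
    rw [hδ]
    field_simp
    ring
  set t : ℝ := t₀ + δ with ht
  set a : Fin n → ℝ := fun i => max (a₀ i - δ) 0 with ha
  have htpos : 0 < t := by
    have : (0 : ℝ) ≤ t₀ := ht₀
    linarith
  have hcl := (isWeakStarClosed_scaledAdjointBall A t).derivList (List.ofFn a)
  have hev : ∀ᶠ g in u, g ∈ szlenkDerivList (List.ofFn a) (scaledAdjointBall A t) ∧
      N * t - ∑ i, a i - p + η / 2 < ‖g - f‖ := by
    have hlim1 : Tendsto (fun g => (q g).1) u (𝓝 t₀) := (continuous_fst.tendsto _).comp hlim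
    have hlim2 : ∀ i, Tendsto (fun g => (q g).2 i) u (𝓝 (a₀ i)) := fun i =>
      (((continuous_apply i).comp continuous_snd).tendsto (t₀, a₀)).comp hlim
    have h2 : ∀ᶠ g in u, ∀ i, (q g).2 i ∈ Set.Ioo (a₀ i - δ) (a₀ i + δ) :=
      eventually_all.2 fun i => hlim2 i (Ioo_mem_nhds (by linarith) (by linarith))
    filter_upwards [hq, hlim1 (Ioo_mem_nhds (sub_lt_self t₀ hδ0) (lt_add_of_pos_right t₀ hδ0)), h2]
      with g ⟨⟨_, hag, hg⟩, hlt⟩ ⟨h1l, h1r⟩ h2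
    refine ⟨szlenkDerivList_ofFn_mono (fun i => max_le (h2 i).1.le (hag i))
      (scaledAdjointBall_mono A h1r.le) hg, ?_⟩
    have hsum : ∑ i, (q g).2 i ≤ ∑ i, a i + n * (2 * δ) := by
      calc ∑ i, (q g).2 i ≤ ∑ i, (a i + 2 * δ) := Finset.sum_le_sum fun i _ => by
            have := (h2 i).2
            have := le_max_left (a₀ i - δ) 0
            simp only [ha]
            linarith
        _ = _ := by simp [Finset.sum_add_distrib]
    have hNt : N * (t - 2 * δ) ≤ N * (q g).1 :=
      mul_le_mul_of_nonneg_left (by simp only [ht]; linarith) hN0.le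
    linarith
  set ε : ℝ := max (N * t - ∑ i, a i - p + η / 2) 0 with hε
  have hfε : f ∈ szlenkDeriv ε (szlenkDerivList (List.ofFn a) (scaledAdjointBall A t)) := by
    have hfr := hev.frequently.filter_mono hu
    rcases le_total (N * t - ∑ i, a i - p + η / 2) 0 with h0 | h0
    · rw [hε, max_eq_right h0]
      exact ⟨hcl f (hfr.mono fun g hg => hg.1), fun h => absurd h (lt_irrefl _)⟩
    · rw [hε, max_eq_left h0]
      exact hcl.mem_szlenkDeriv hfr
  have hle := szlenkPotential_le N A (a := Fin.cons ε a) htpos (f := f) (by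
    intro i
    cases i using Fin.cases with
    | zero => exact le_max_right _ _
    | succ i => exact le_max_right _ _) (by
    rw [List.ofFn_succ]
    simpa [szlenkDerivList_cons] using hfε)
  have hs := list_sum_le_of_mem_szlenkDerivList hA htpos
    (l := ε :: List.ofFn a) (f := f) hfε
  rw [List.sum_cons, List.sum_ofFn] at hs
  have hCt := mul_pos hC0 htpos
  rw [hfp, Fin.sum_univ_succ] at hle
  simp only [Fin.cons_zero, Fin.cons_succ] at hle
  rw [ENNReal.ofReal_le_ofReal_iff (by linarith)] at hle
  have := le_max_left (N * t - ∑ i, a i - p + η / 2) 0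
  linarith

end Potential

/-! ### The dual of a `c₀`-direct sum -/

section C0Sum

variable {Λ : Type*} {𝕜 : Type*} [RCLike 𝕜]
variable {X : Λ → Type*} [∀ i, NormedAddCommGroup (X i)] [∀ i, NormedSpace 𝕜 (X i)]
variable {Y : Λ → Type*} [∀ i, NormedAddCommGroup (Y i)] [∀ i, NormedSpace 𝕜 (Y i)]

/-- The coordinate projection of a `c₀`-direct sum. -/
noncomputable def c0Proj (𝕜 : Type*) [RCLike 𝕜] (X : Λ → Type*) [∀ i, NormedAddCommGroup (X i)]
    [∀ i, NormedSpace 𝕜 (X i)] (i : Λ) : c0Sum 𝕜 X →L[𝕜] X i :=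
  LinearMap.mkContinuous
    { toFun := fun x => (x : lp X ∞) i
      map_add' := fun _ _ => rfl
      map_smul' := fun _ _ => rfl } 1
    (fun x => by
      rw [one_mul]
      exact lp.norm_apply_le_norm ENNReal.top_ne_zero (x : lp X ∞) i)

open Classical in
/-- The coordinate embedding into a `c₀`-direct sum. -/
noncomputable def c0Single (𝕜 : Type*) [RCLike 𝕜] (X : Λ → Type*) [∀ i, NormedAddCommGroup (X i)]
    [∀ i, NormedSpace 𝕜 (X i)] (i : Λ) : X i →L[𝕜] c0Sum 𝕜 X :=
  LinearMap.mkContinuous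
    ((lp.lsingle (𝕜 := 𝕜) (E := X) ∞ i).codRestrict (c0Sum 𝕜 X) (fun x => by
      refine tendsto_const_nhds.congr' ?_
      filter_upwards [(Set.finite_singleton i).compl_mem_cofinite] with j hj
      have hj : j ≠ i := hj
      change 0 = ‖lp.single ∞ i x j‖
      rw [lp.single_apply_ne _ _ _ hj, norm_zero])) 1
    (fun x => by
      rw [one_mul]
      exact (lp.norm_single ENNReal.zero_lt_top i x).le)

theorem c0Sum_ext {x y : c0Sum 𝕜 X} (h : ∀ i, c0Proj 𝕜 X i x = c0Proj 𝕜 X i y) : x = y :=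
  Subtype.ext (lp.ext (funext h))

theorem c0Sum_norm_le {x : c0Sum 𝕜 X} {r : ℝ} (hr : 0 ≤ r) (h : ∀ i, ‖c0Proj 𝕜 X i x‖ ≤ r) :
    ‖x‖ ≤ r :=
  lp.norm_le_of_forall_le hr h

theorem c0Proj_c0Single_self (i : Λ) (x : X i) : c0Proj 𝕜 X i (c0Single 𝕜 X i x) = x := by
  classical
  exact lp.single_apply_self (E := X) ∞ i x

theorem c0Proj_c0Single_ne {i j : Λ} (h : j ≠ i) (x : X i) :
    c0Proj 𝕜 X j (c0Single 𝕜 X i x) = 0 := by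
  classical
  exact lp.single_apply_ne (E := X) ∞ i x h

theorem norm_c0Proj_apply_le (i : Λ) (x : c0Sum 𝕜 X) : ‖c0Proj 𝕜 X i x‖ ≤ ‖x‖ :=
  lp.norm_apply_le_norm ENNReal.top_ne_zero (x : lp X ∞) i

theorem norm_c0Single_apply_le (i : Λ) (x : X i) : ‖c0Single 𝕜 X i x‖ ≤ ‖x‖ := by
  refine c0Sum_norm_le (norm_nonneg _) fun j => ?_
  rcases eq_or_ne j i with rfl | hj
  · rw [c0Proj_c0Single_self]
  · rw [c0Proj_c0Single_ne hj, norm_zero]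
    exact norm_nonneg _

theorem norm_c0Proj_le (i : Λ) : ‖c0Proj 𝕜 X i‖ ≤ 1 :=
  ContinuousLinearMap.opNorm_le_bound _ zero_le_one fun x => by
    rw [one_mul]; exact norm_c0Proj_apply_le i x

theorem norm_c0Single_le (i : Λ) : ‖c0Single 𝕜 X i‖ ≤ 1 :=
  ContinuousLinearMap.opNorm_le_bound _ zero_le_one fun x => by
    rw [one_mul]; exact norm_c0Single_apply_le i x

theorem c0Proj_sum_c0Single (s : Finset Λ) (x : ∀ i, X i) (j : Λ) [Decidable (j ∈ s)] :
    c0Proj 𝕜 X j (∑ i ∈ s, c0Single 𝕜 X i (x i)) = if j ∈ s then x j else 0 := by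
  rw [map_sum]
  split_ifs with hj
  · rw [Finset.sum_eq_single_of_mem j hj fun i _ hij => c0Proj_c0Single_ne hij.symm _,
      c0Proj_c0Single_self]
  · exact Finset.sum_eq_zero fun i hi => c0Proj_c0Single_ne (ne_of_mem_of_not_mem hi hj).symm _

theorem hasSum_c0Single (x : c0Sum 𝕜 X) :
    HasSum (fun i => c0Single 𝕜 X i (c0Proj 𝕜 X i x)) x := by
  classical
  refine Metric.tendsto_atTop.2 fun ε hε => ?_
  have hx : Tendsto (fun i => ‖c0Proj 𝕜 X i x‖) cofinite (𝓝 0) := x.2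
  have hfin : {i | ¬ ‖c0Proj 𝕜 X i x‖ < ε / 2}.Finite :=
    eventually_cofinite.1 (hx.eventually_lt_const (half_pos hε))
  refine ⟨hfin.toFinset, fun s hs => lt_of_le_of_lt ?_ (half_lt_self hε)⟩
  rw [dist_eq_norm]
  refine c0Sum_norm_le (half_pos hε).le fun j => ?_
  rw [map_sub, c0Proj_sum_c0Single]
  split_ifs with hj
  · rw [sub_self, norm_zero]
    exact (half_pos hε).le
  · rw [zero_sub, norm_neg]
    by_contra hlt
    exact hj (hs (hfin.mem_toFinset.2 fun h => hlt h.le))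

theorem ofReal_norm_le_tsum_enorm_comp_c0Single (f : StrongDual 𝕜 (c0Sum 𝕜 X)) :
    ENNReal.ofReal ‖f‖ ≤ ∑' i, ‖f.comp (c0Single 𝕜 X i)‖ₑ := by
  by_cases htop : ∑' i, ‖f.comp (c0Single 𝕜 X i)‖ₑ = ∞
  · rw [htop]; exact le_top
  rw [← ENNReal.ofReal_toReal htop]
  refine ENNReal.ofReal_le_ofReal <| f.opNorm_le_bound ENNReal.toReal_nonneg fun x => ?_
  have hlim := ((f.hasSum (hasSum_c0Single x)).norm :)
  refine le_of_tendsto hlim (Eventually.of_forall fun s => ?_)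
  calc ‖∑ i ∈ s, f (c0Single 𝕜 X i (c0Proj 𝕜 X i x))‖
      ≤ ∑ i ∈ s, ‖f.comp (c0Single 𝕜 X i)‖ * ‖x‖ := norm_sum_le_of_le s fun i _ =>
        ((f.comp (c0Single 𝕜 X i)).le_opNorm _).trans
          (mul_le_mul_of_nonneg_left (norm_c0Proj_apply_le i x) (norm_nonneg _))
    _ = (∑ i ∈ s, ‖f.comp (c0Single 𝕜 X i)‖) * ‖x‖ := (Finset.sum_mul ..).symm
    _ ≤ _ := by
      refine mul_le_mul_of_nonneg_right ?_ (norm_nonneg _)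
      rw [← ENNReal.ofReal_le_iff_le_toReal htop,
        ENNReal.ofReal_sum_of_nonneg fun i _ => norm_nonneg _]
      simp only [ofReal_norm]
      exact ENNReal.sum_le_tsum s

theorem sum_norm_comp_c0Single_le (f : StrongDual 𝕜 (c0Sum 𝕜 X)) (s : Finset Λ) :
    ∑ i ∈ s, ‖f.comp (c0Single 𝕜 X i)‖ ≤ ‖f‖ := by
  classical
  refine le_of_forall_pos_le_add fun ε hε => ?_
  -- norming vectors, rotated so that the functional is real and non-negative on them
  have hex : ∀ i, ∃ x : X i, ‖x‖ ≤ 1 ∧ ‖f.comp (c0Single 𝕜 X i)‖ - ε / (s.card + 1) ≤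
      RCLike.re (f (c0Single 𝕜 X i x)) := by
    intro i
    obtain ⟨x, hx, hlt⟩ := (f.comp (c0Single 𝕜 X i)).exists_lt_apply_of_lt_opNorm
      (r := ‖f.comp (c0Single 𝕜 X i)‖ - ε / (s.card + 1)) (sub_lt_self _ (by positivity))
    obtain ⟨c, hc, hcx⟩ := RCLike.exists_norm_eq_mul_self (f (c0Single 𝕜 X i x))
    refine ⟨c • x, by rw [norm_smul, hc, one_mul]; exact hx.le, ?_⟩
    rw [map_smul, map_smul, smul_eq_mul, ← hcx, RCLike.ofReal_re]
    exact hlt.le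
  choose x hx hfx using hex
  have hnorm : ‖∑ i ∈ s, c0Single 𝕜 X i (x i)‖ ≤ 1 := by
    refine c0Sum_norm_le zero_le_one fun j => ?_
    rw [c0Proj_sum_c0Single]
    split_ifs
    · exact hx j
    · simp
  have hle : ∑ i ∈ s, RCLike.re (f (c0Single 𝕜 X i (x i))) ≤ ‖f‖ := by
    calc ∑ i ∈ s, RCLike.re (f (c0Single 𝕜 X i (x i)))
        = RCLike.re (f (∑ i ∈ s, c0Single 𝕜 X i (x i))) := by rw [map_sum, map_sum]
      _ ≤ ‖f (∑ i ∈ s, c0Single 𝕜 X i (x i))‖ := RCLike.re_le_norm _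
      _ ≤ ‖f‖ := f.unit_le_opNorm _ hnorm
  have hcard : (s.card : ℝ) * (ε / (s.card + 1)) ≤ ε := by
    rw [mul_div_assoc', div_le_iff₀ (by positivity)]
    linarith
  have hsum := Finset.sum_le_sum fun i (_ : i ∈ s) => hfx i
  rw [Finset.sum_sub_distrib, Finset.sum_const, nsmul_eq_mul] at hsum
  linarith

theorem tsum_enorm_comp_c0Single_le (f : StrongDual 𝕜 (c0Sum 𝕜 X)) :
    ∑' i, ‖f.comp (c0Single 𝕜 X i)‖ₑ ≤ ENNReal.ofReal ‖f‖ := by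
  rw [ENNReal.tsum_eq_iSup_sum]
  refine iSup_le fun s => ?_
  simp only [← ofReal_norm]
  rw [← ENNReal.ofReal_sum_of_nonneg fun i _ => norm_nonneg _]
  exact ENNReal.ofReal_le_ofReal (sum_norm_comp_c0Single_le f s)

theorem c0SumMap_c0Single (A : ∀ i, X i →L[𝕜] Y i)
    (hA : BddAbove (Set.range fun i => ‖A i‖)) (i : Λ) :
    (c0SumMap A hA).comp (c0Single 𝕜 X i) = (c0Single 𝕜 Y i).comp (A i) := by
  ext1 x
  refine c0Sum_ext fun j => ?_
  change A j (c0Proj 𝕜 X j (c0Single 𝕜 X i x)) = c0Proj 𝕜 Y j (c0Single 𝕜 Y i (A i x))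
  rcases eq_or_ne j i with rfl | hj
  · rw [c0Proj_c0Single_self, c0Proj_c0Single_self]
  · rw [c0Proj_c0Single_ne hj, c0Proj_c0Single_ne hj, map_zero]

theorem tendsto_comp_weakStarNhds {E F : Type*} [NormedAddCommGroup E] [NormedSpace 𝕜 E]
    [NormedAddCommGroup F] [NormedSpace 𝕜 F] (B : E →L[𝕜] F) (f : StrongDual 𝕜 F) :
    Tendsto (fun g : StrongDual 𝕜 F => g.comp B) (weakStarNhds f) (weakStarNhds (f.comp B)) :=
  tendsto_weakStarNhds fun x => tendsto_apply_weakStarNhds f (B x)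

/-- Summability of the Szlenk index passes, with the same constant, to an operator `A` obtained
from `B` by a norm-one retraction `P` of the domain: the adjoint of `P` is a weak-star continuous
isometric embedding that maps the dual ball image of `A` into that of `B`. -/
theorem HasSummableSzlenkIndexWith.of_retraction {E E' F F' : Type*}
    [NormedAddCommGroup E] [NormedSpace 𝕜 E] [NormedAddCommGroup E'] [NormedSpace 𝕜 E']
    [NormedAddCommGroup F] [NormedSpace 𝕜 F] [NormedAddCommGroup F'] [NormedSpace 𝕜 F']
    {B : E →L[𝕜] F} {A : E' →L[𝕜] F'} {M : ℝ} (hB : HasSummableSzlenkIndexWith M B)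
    {P : E →L[𝕜] E'} {J : E' →L[𝕜] E} {Q : F →L[𝕜] F'} (hP : ‖P‖ ≤ 1) (hJ : ‖J‖ ≤ 1)
    (hQ : ‖Q‖ ≤ 1) (hPJ : ∀ x, P (J x) = x) (hAP : A.comp P = Q.comp B) :
    HasSummableSzlenkIndexWith M A := by
  have hnorm : ∀ f : StrongDual 𝕜 E', ‖f.comp P‖ = ‖f‖ := by
    intro f
    refine le_antisymm ((f.opNorm_comp_le _).trans
      (mul_le_of_le_one_right (norm_nonneg _) hP)) ?_
    have hf : (f.comp P).comp J = f := by
      ext1 x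
      exact congrArg f (hPJ x)
    calc ‖f‖ = ‖(f.comp P).comp J‖ := by rw [hf]
      _ ≤ ‖f.comp P‖ * ‖J‖ := ContinuousLinearMap.opNorm_comp_le _ _
      _ ≤ ‖f.comp P‖ := mul_le_of_le_one_right (norm_nonneg _) hJ
  have hmaps : Set.MapsTo (fun f : StrongDual 𝕜 E' => f.comp P) (adjointBall A)
      (adjointBall B) := by
    rintro _ ⟨k, hk, rfl⟩
    rw [mem_closedBall_zero_iff] at hk
    refine ⟨k.comp Q, mem_closedBall_zero_iff.2 ?_, ?_⟩
    · exact (k.opNorm_comp_le _).trans (mul_le_one₀ hk (norm_nonneg _) hQ)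
    · dsimp only
      rw [ContinuousLinearMap.comp_assoc, ContinuousLinearMap.comp_assoc, hAP]
  have hdist : ∀ f g : StrongDual 𝕜 E', dist (f.comp P) (g.comp P) = 1 * dist f g := fun f g => by
    rw [one_mul, dist_eq_norm, dist_eq_norm, ← ContinuousLinearMap.sub_comp, hnorm]
  rintro l ⟨f, hf⟩
  simpa using hB _ ⟨_, mapsTo_szlenkDerivList one_pos hdist
    (tendsto_comp_weakStarNhds P) hmaps l hf⟩

theorem HasSummableSzlenkIndexWith.of_c0SumMap {A : ∀ i, X i →L[𝕜] Y i}
    {hA : BddAbove (Set.range fun i => ‖A i‖)} {M : ℝ}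
    (h : HasSummableSzlenkIndexWith M (c0SumMap A hA)) (i : Λ) :
    HasSummableSzlenkIndexWith M (A i) :=
  h.of_retraction (norm_c0Proj_le i) (norm_c0Single_le i) (norm_c0Proj_le (X := Y) i)
    (c0Proj_c0Single_self i) rfl

end C0Sum

/-! ### The potential of a direct sum -/

section SumPotential

variable {Λ : Type*} {𝕜 : Type*} [RCLike 𝕜]
variable {X : Λ → Type*} [∀ i, NormedAddCommGroup (X i)] [∀ i, NormedSpace 𝕜 (X i)]
variable {Y : Λ → Type*} [∀ i, NormedAddCommGroup (Y i)] [∀ i, NormedSpace 𝕜 (Y i)]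

/-- The sum over all coordinates of the `n`-step potentials of the operators `A i`. -/
noncomputable def sumPotential (N : ℝ) (A : ∀ i, X i →L[𝕜] Y i) (n : ℕ)
    (f : StrongDual 𝕜 (c0Sum 𝕜 X)) : ℝ≥0∞ :=
  ∑' i, szlenkPotential N (A i) n (f.comp (c0Single 𝕜 X i))

theorem sumPotential_succ_le (N : ℝ) (A : ∀ i, X i →L[𝕜] Y i) (n : ℕ)
    (f : StrongDual 𝕜 (c0Sum 𝕜 X)) : sumPotential N A (n + 1) f ≤ sumPotential N A n f :=
  ENNReal.tsum_le_tsum fun i => szlenkPotential_succ_le N (A i) n _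

theorem sumPotential_zero_le {N : ℝ} (hN : 0 ≤ N) {A : ∀ i, X i →L[𝕜] Y i}
    {hA : BddAbove (Set.range fun i => ‖A i‖)} {f : StrongDual 𝕜 (c0Sum 𝕜 X)}
    (hf : f ∈ adjointBall (c0SumMap (X := X) (Y := Y) A hA)) :
    sumPotential N A 0 f ≤ ENNReal.ofReal N := by
  obtain ⟨h, hh, rfl⟩ := mem_adjointBall_iff.1 hf
  calc sumPotential N A 0 (h.comp (c0SumMap A hA))
      ≤ ∑' i, ENNReal.ofReal N * ‖h.comp (c0Single 𝕜 Y i)‖ₑ := by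
        refine ENNReal.tsum_le_tsum fun i => ?_
        rw [ContinuousLinearMap.comp_assoc, c0SumMap_c0Single, ← ContinuousLinearMap.comp_assoc,
          ← ofReal_norm, ← ENNReal.ofReal_mul hN]
        exact szlenkPotential_zero_comp_le (A i) _
    _ = ENNReal.ofReal N * ∑' i, ‖h.comp (c0Single 𝕜 Y i)‖ₑ := ENNReal.tsum_mul_left
    _ ≤ ENNReal.ofReal N * ENNReal.ofReal ‖h‖ := by gcongr; exact tsum_enorm_comp_c0Single_le h
    _ ≤ ENNReal.ofReal N * 1 := by
        gcongr
        exact ENNReal.ofReal_le_one.2 hh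
    _ = ENNReal.ofReal N := mul_one _

/-- Bookkeeping for the direct sum: `φ`, `ψ`, `d` stand for the potentials of the limit, the
potentials of a nearby functional, and the coordinate distances; `s` is the set of coordinates on
which the drop is estimated summand by summand. -/
theorem tsum_add_tsum_le_of_split {ι : Type*} {φ ψ d : ι → ℝ≥0∞} {δ : ℝ≥0∞} (s : Finset ι)
    (hs : ∀ i ∈ s, φ i + d i ≤ ψ i + δ) (htail : ∀ i, d i ≤ ψ i + φ i) :
    ∑' i, φ i + ∑' i, d i ≤ ∑' i, ψ i +
      (∑ _i ∈ s, δ + ∑' i : {i // i ∉ s}, φ i + ∑' i : {i // i ∉ s}, φ i) := by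
  have hsplit : ∀ u : ι → ℝ≥0∞, ∑' i, u i = ∑ i ∈ s, u i + ∑' i : {i // i ∉ s}, u i :=
    fun u => (ENNReal.sum_add_tsum_compl s u).symm
  calc ∑' i, φ i + ∑' i, d i
      = ∑ i ∈ s, (φ i + d i) + (∑' i : {i // i ∉ s}, φ i + ∑' i : {i // i ∉ s}, d i) := by
        rw [hsplit φ, hsplit d, Finset.sum_add_distrib]
        ring
    _ ≤ ∑ i ∈ s, (ψ i + δ) + (∑' i : {i // i ∉ s}, φ i +
          (∑' i : {i // i ∉ s}, ψ i + ∑' i : {i // i ∉ s}, φ i)) := by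
        refine add_le_add (Finset.sum_le_sum hs) (add_le_add le_rfl ?_)
        rw [← ENNReal.tsum_add]
        exact ENNReal.tsum_le_tsum fun i => htail i
    _ = _ := by
        rw [hsplit ψ, Finset.sum_add_distrib]
        ring

/-- In the weak-star limit the potential of the direct sum drops at least by the distance to the
limit. On the finitely many coordinates carrying most of the potential of `f` this is the
corresponding fact for each summand; on the others the potential dominates the norm, so it pays
for the mass of `g` that escapes in the limit. -/
theorem eventually_sumPotential_succ_add_le {A : ∀ i, X i →L[𝕜] Y i} {C M : ℝ} (hC0 : 0 < C)
    (hM : 0 ≤ M) (hC : ∀ i, ‖A i‖ ≤ C) (hA : ∀ i, HasSummableSzlenkIndexWith M (A i)) (n : ℕ)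
    {f : StrongDual 𝕜 (c0Sum 𝕜 X)} (hf : sumPotential (2 * C + M) A (n + 1) f ≠ ∞) {η : ℝ}
    (hη : 0 < η) :
    ∀ᶠ g in weakStarNhds f, sumPotential (2 * C + M) A (n + 1) f + ENNReal.ofReal ‖g - f‖ ≤
      sumPotential (2 * C + M) A n g + ENNReal.ofReal η := by
  set N : ℝ := 2 * C + M with hN
  set φ : Λ → ℝ≥0∞ := fun i => szlenkPotential N (A i) (n + 1) (f.comp (c0Single 𝕜 X i)) with hφ
  have hφtop : ∑' i, φ i ≠ ∞ := hf
  have hη3 : 0 < η / 3 := by positivity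
  obtain ⟨s, hs⟩ : ∃ s : Finset Λ, ∑' i : {i // i ∉ s}, φ i < ENNReal.ofReal (η / 3) :=
    ((ENNReal.tendsto_tsum_compl_atTop_zero hφtop).eventually_lt_const
      (ENNReal.ofReal_pos.2 hη3)).exists
  set δ : ℝ := η / 3 / (s.card + 1) with hδ
  have hδ0 : 0 < δ := by positivity
  have hδs : ∑ _i ∈ s, ENNReal.ofReal δ ≤ ENNReal.ofReal (η / 3) := by
    rw [Finset.sum_const, nsmul_eq_mul, ← ENNReal.ofReal_natCast,
      ← ENNReal.ofReal_mul (Nat.cast_nonneg _)]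
    refine ENNReal.ofReal_le_ofReal ?_
    rw [hδ, mul_div_assoc', div_le_iff₀ (by positivity)]
    linarith
  have hev : ∀ᶠ g in weakStarNhds f, ∀ i ∈ s, φ i +
      ‖(g - f).comp (c0Single 𝕜 X i)‖ₑ ≤
        szlenkPotential N (A i) n (g.comp (c0Single 𝕜 X i)) + ENNReal.ofReal δ := by
    refine (eventually_all_finset s).2 fun i _ => ?_
    have h := (tendsto_comp_weakStarNhds (c0Single 𝕜 X i) f).eventually
      (eventually_szlenkPotential_succ_add_le hC0 hM (hC i) (hA i) n
        (ENNReal.ne_top_of_tsum_ne_top hφtop i) hδ0)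
    filter_upwards [h] with g hg
    rw [← ofReal_norm, ContinuousLinearMap.sub_comp]
    exact hg
  filter_upwards [hev] with g hg
  have htail : ∀ i, ‖(g - f).comp (c0Single 𝕜 X i)‖ₑ ≤
      szlenkPotential N (A i) n (g.comp (c0Single 𝕜 X i)) + φ i := fun i => by
    rw [ContinuousLinearMap.sub_comp]
    exact enorm_sub_le.trans (add_le_add (enorm_le_szlenkPotential (hC i) (hA i) n _)
      (enorm_le_szlenkPotential (hC i) (hA i) (n + 1) _))
  calc sumPotential N A (n + 1) f + ENNReal.ofReal ‖g - f‖
      ≤ ∑' i, φ i + ∑' i, ‖(g - f).comp (c0Single 𝕜 X i)‖ₑ :=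
        add_le_add le_rfl (ofReal_norm_le_tsum_enorm_comp_c0Single (g - f))
    _ ≤ sumPotential N A n g + (ENNReal.ofReal (η / 3) + ENNReal.ofReal (η / 3) +
          ENNReal.ofReal (η / 3)) :=
        (tsum_add_tsum_le_of_split s hg htail).trans
          (add_le_add le_rfl (add_le_add (add_le_add hδs hs.le) hs.le))
    _ = sumPotential N A n g + ENNReal.ofReal η := by
        rw [← ENNReal.ofReal_add hη3.le hη3.le, ← ENNReal.ofReal_add (by positivity) hη3.le]
        congr 2
        ring

/-- Each derivation `s_ε` lowers the potential by `ε / 2`. -/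
theorem sumPotential_succ_add_le_of_mem_szlenkDeriv {A : ∀ i, X i →L[𝕜] Y i} {C M : ℝ}
    (hC0 : 0 < C) (hM : 0 ≤ M) (hC : ∀ i, ‖A i‖ ≤ C)
    (hA : ∀ i, HasSummableSzlenkIndexWith M (A i)) (n : ℕ) {c : ℝ≥0∞} (hc : c ≠ ∞)
    {K : Set (StrongDual 𝕜 (c0Sum 𝕜 X))} (hK : ∀ g ∈ K, sumPotential (2 * C + M) A n g ≤ c)
    {ε : ℝ} {f : StrongDual 𝕜 (c0Sum 𝕜 X)} (hf : f ∈ szlenkDeriv ε K) :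
    sumPotential (2 * C + M) A (n + 1) f + ENNReal.ofReal (ε / 2) ≤ c := by
  have hle := (sumPotential_succ_le (2 * C + M) A n f).trans (hK f hf.1)
  rcases le_or_gt ε 0 with hε | hε
  · rwa [ENNReal.ofReal_of_nonpos (by linarith), add_zero]
  refine ENNReal.le_of_forall_pos_le_add fun η hη _ => ?_
  obtain ⟨g, hgK, hg, hgf⟩ := exists_half_lt_of_mem_szlenkDeriv hε hf
    (eventually_sumPotential_succ_add_le hC0 hM hC hA n (ne_top_of_le_ne_top hc hle)
      (NNReal.coe_pos.2 hη))
  rw [ENNReal.ofReal_coe_nnreal] at hg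
  calc sumPotential (2 * C + M) A (n + 1) f + ENNReal.ofReal (ε / 2)
      ≤ sumPotential (2 * C + M) A (n + 1) f + ENNReal.ofReal ‖g - f‖ := by gcongr
    _ ≤ sumPotential (2 * C + M) A n g + η := hg
    _ ≤ c + η := by gcongr; exact hK g hgK

theorem hasSummableSzlenkIndexWith_c0SumMap {A : ∀ i, X i →L[𝕜] Y i}
    {hA : BddAbove (Set.range fun i => ‖A i‖)} {C M : ℝ} (hC0 : 0 < C) (hM : 0 ≤ M)
    (hC : ∀ i, ‖A i‖ ≤ C) (h : ∀ i, HasSummableSzlenkIndexWith M (A i)) :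
    HasSummableSzlenkIndexWith (2 * (2 * C + M)) (c0SumMap A hA) := by
  have hN : 0 ≤ 2 * C + M := by positivity
  -- the second clause keeps the real number inside `ENNReal.ofReal` non-negative
  have key : ∀ l : List ℝ,
      ∀ f ∈ szlenkDerivList l (adjointBall (c0SumMap (X := X) (Y := Y) A hA)),
      sumPotential (2 * C + M) A l.length f ≤ ENNReal.ofReal (2 * C + M - l.sum / 2) ∧
        l.sum / 2 ≤ 2 * C + M := by
    intro l
    induction l with
    | nil =>
      intro f hf
      simpa using ⟨sumPotential_zero_le hN hf, hN⟩
    | cons ε l ih =>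
      intro f hf
      have hle := sumPotential_succ_add_le_of_mem_szlenkDeriv hC0 hM hC h l.length
        ENNReal.ofReal_ne_top (fun g hg => (ih g hg).1) hf
      have hl := (ih f hf.1).2
      have hε : ε / 2 ≤ 2 * C + M - l.sum / 2 :=
        (ENNReal.ofReal_le_ofReal_iff (by linarith)).1 (le_add_self.trans hle)
      rw [List.sum_cons, List.length_cons]
      refine ⟨?_, by linarith⟩
      rcases le_total 0 ε with h0 | h0
      · rw [show 2 * C + M - (ε + l.sum) / 2 = 2 * C + M - l.sum / 2 - ε / 2 by ring,
          ENNReal.ofReal_sub _ (by linarith)]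
        exact ENNReal.le_sub_of_add_le_right ENNReal.ofReal_ne_top hle
      · exact (le_self_add.trans hle).trans (ENNReal.ofReal_le_ofReal (by linarith))
  rintro l ⟨f, hf⟩
  linarith [(key l f hf).2]

end SumPotential

/-! ### Summable Szlenk index of direct sums of operators -/

theorem mainTheorem4 {𝕜 : Type*} [RCLike 𝕜] {Λ : Type*} [Nonempty Λ]
    {X : Λ → Type*} [∀ i, NormedAddCommGroup (X i)] [∀ i, NormedSpace 𝕜 (X i)]
    [∀ i, CompleteSpace (X i)]
    {Y : Λ → Type*} [∀ i, NormedAddCommGroup (Y i)] [∀ i, NormedSpace 𝕜 (Y i)]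
    [∀ i, CompleteSpace (Y i)]
    (A : ∀ i, X i →L[𝕜] Y i) (hA : BddAbove (Set.range fun i => ‖A i‖)) :
    HasSummableSzlenkIndex (c0SumMap A hA) ↔
      ∃ M : ℝ, 0 ≤ M ∧ ∀ i, HasSummableSzlenkIndexWith M (A i) := by
  refine ⟨fun ⟨M, hM, h⟩ => ⟨M, hM, fun i => h.of_c0SumMap i⟩, fun ⟨M, hM, h⟩ => ?_⟩
  obtain ⟨C, hC⟩ := hA
  have hC' : ∀ i, ‖A i‖ ≤ max C 1 := fun i => (hC ⟨i, rfl⟩).trans (le_max_left _ _)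
  have hC0 : 0 < max C 1 := zero_lt_one.trans_le (le_max_right _ _)
  exact ⟨_, by positivity, hasSummableSzlenkIndexWith_c0SumMap hC0 hM hC' h⟩
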